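/- **Setting.** Let $V$ be a finite linearly ordered set of (live) nodes, identified with their keys, and let each node $x$ have a membership vector $m(x)=m(x)_0m(x)_1\dots$, an infinite word over an alphabet; distinct nodes have distinct membership vectors. Write $m(x)\upharpoonright\ell$ for the prefix of length $\ell$. At each level $\ell\ge 0$ each node $x$ stores two pointers $xR_\ell,xL_\ell\in V\cup\{\bot\}$. For a side $s\in\{L,R\}$ let $\bar s$ be the other side, and let $a<_s b$ mean $a<b$ if $s=R$ and $b<a$ if $s=L$. Two nodes are in the same connected component if they are joined by a path of pointers (of any levels and sides, used in either direction). The pointers form a *(defectless) skip graph* if in each connected component $C$ and for all $x\in C$, $\ell\ge0$, the pointer $xR_\ell$ (resp. $xL_\ell$) is the immediate successor (resp. predecessor) of $x$ in $\{y\in C: m(y)\upharpoonright\ell=m(x)\upharpoonright\ell\}$, and is $\bot$ if there is none. So each component has one sorted doubly-linked list at level $0$, and one at level $|w|$ for each word $w$ that is a prefix of a membership vector in it. A *(possibly) defective skip graph* is any choice of pointers such that $xs_\ell=y\ne\bot$ implies $x<_s y$ and $m(x)\upharpoonright\ell=m(y)\upharpoonright\ell$. Pointers may be missing, one-sided, skip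 nodes, or be inconsistent between levels. Finitely many messages of the mechanism below may be in transit, provided that they too only concern pairs of nodes in the right order and with the prefixes in common that their level requires: the receiver $v$ and the node named in a message check, probe, zipper, update, getLink for $(s,\ell)$ satisfy $v<_s y$, $m(v)\upharpoonright\ell=m(y)\upharpoonright\ell$; a message buddy$(s,x,\ell)$ or levelCheck$(s,x,z,\ell)$ at $v$ satisfies $x<_s v$, $m(x)\upharpoonright\ell=m(v)\upharpoonright\ell$, and in the latter case $x<_s z$, $m(x)\upharpoonright(\ell+1)=m(z)\upharpoonright(\ell+1)$. **The repair mechanism.** Each node $v$ repeatedly performs, for each $s$ and $\ell$: * *Backpointer check.* If $vs_\ell\neq\bot$, send check$(\bar s,v,\ell)$ to $vs_\ell$. * *Inter-level check.* If $vs_{\ell+1}=z\ne\bot$: send levelCheck$(s,v,z,\ell)$ to $vs_\ell$ if $vs_\ell\ne\bot$, and probe$(\bar s,v,\ell)$ to $z$ if $vs_\ell=\bot$. If $vs_{\ell+1}=\bot$ and $vs_\ell\neq\bot$: send buddy$(s,v,\ell)$ to $vs_\ell$. A node $v$ that receives a message reacts atomically as follows. * check$(s,n,\ell)$: if $vs_\ell=n$,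 nothing. If $vs_\ell=\bot$ (and $v<_s n$), set $vs_\ell:=n$ and send check$(\bar s,v,\ell)$ to $n$. If $vs_\ell=w<_s n$, send check$(s,n,\ell)$ to $w$. Otherwise, with $w=vs_\ell$, send check$(\bar s,n,\ell)$ to $w$, check$(\bar s,v,\ell)$ and check$(s,w,\ell)$ to $n$, and set $vs_\ell:=n$. * levelCheck$(s,x,z,\ell)$: if $v<_s z$ and $m(v)\upharpoonright(\ell+1)=m(x)\upharpoonright(\ell+1)$, start probe$(s,z,\ell+1)$ and probe$(\bar s,x,\ell+1)$ at $v$. Otherwise, if $v<_s z$ and $vs_\ell=\bot$, send probe$(\bar s,v,\ell)$ to $z$; if $v<_s z$ and $vs_\ell\neq\bot$, pass the message on to $vs_\ell$. If $v=z$, nothing. If $z<_s v$, send probe$(s,v,\ell)$ to $z$ and, if $v\bar s_\ell=b\ne\bot$ with $b<_s z$, also probe$(\bar s,b,\ell)$ to $z$. * probe$(s,t,\ell)$: if $vs_\ell\ne\bot$ and $vs_\ell<_s t$, pass the message on to $vs_\ell$; otherwise send zipper$(s,t,\ell)$ to $v$ itself. * zipper$(s,t,\ell)$: if $vs_\ell=t$,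 nothing. If $vs_\ell\ne\bot$ and $vs_\ell<_s t$, pass the message on to $vs_\ell$. Otherwise let $w=vs_\ell$, set $vs_\ell:=t$, send update$(\bar s,v,\ell)$ to $t$ and, if $w\ne\bot$, zipper$(s,w,\ell)$ to $t$. * update$(s,n,\ell)$: set $vs_\ell:=n$. * buddy$(s,x,\ell)$: if $m(v)_\ell=m(x)_\ell$, react as to getLink$(\bar s,x,\ell+1)$; otherwise pass the message on to $vs_\ell$, if this is not $\bot$. * getLink$(s,u,\ell)$: if $vs_\ell\neq\bot$ and $vs_\ell<_s u$, pass the message on to $vs_\ell$; otherwise set $vs_\ell:=u$ and send update$(\bar s,v,\ell)$ to $u$. An *execution* is an infinite sequence of atomic events (a check by a node, the receipt of a message in transit by its receiver, or an idle event) in which there are no failures, inserts or deletes, every node performs each of its checks infinitely often, and every message in transit is eventually received; delays are otherwise arbitrary and messages may overtake each other. **Theorem.** In every execution of the repair mechanism that starts from a defective skip graph, the pointers form a defectless skip graph after finitely many events, and from then on they never change. -/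

import Mathlib

namespace SkipGraph

/-- The two directions of a doubly-linked list: predecessors (`L`) and successors (`R`). -/
inductive Side
  | L
  | R

/-- The opposite side. -/
def Side.opp : Side → Side
  | .L => .R
  | .R => .L

/-- `s.before a b`: walking in direction `s`, node `a` comes strictly before node `b`.
Nodes are identified with their keys, so `R` walks upwards and `L` walks downwards. -/
def Side.before {V : Type*} [LT V] : Side → V → V → Prop
  | .R, a, b => a < b
  | .L, a, b => b < a

/-- The membership vectors of `x` and `y` have the same prefix of length `ℓ`, that is, both nodes
belong to the same level-`ℓ` list. -/
def Agree {V A : Type*} (m : V → ℕ → A) (ℓ : ℕ) (x y : V) : Prop :=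
  ∀ i < ℓ, m x i = m y i

/-- The neighbour tables of all nodes: `p s ℓ x` is the level-`ℓ` neighbour of `x` on side `s`
(written `x R_ℓ` or `x L_ℓ` on paper), and `none` stands for the null pointer. -/
abbrev Pointers (V : Type*) := Side → ℕ → V → Option V

/-! ### Skip graphs -/

/-- Some pointer of `x` points to `y`. -/
def Linked {V : Type*} (p : Pointers V) (x y : V) : Prop :=
  ∃ s ℓ, p s ℓ x = some y

/-- `x` and `y` lie in the same connected component of the data structure: they are joined by a
path of pointers, of any levels and sides, each of them used in either direction. -/
def Connected {V : Type*} (p : Pointers V) (x y : V) : Prop :=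
  Relation.EqvGen (Linked p) x y

/-- `y` is the immediate neighbour of `x` on side `s` in the list that consists, in increasing
order, of all nodes of the connected component of `x` whose membership vector has the same prefix
of length `ℓ` as that of `x`. -/
def IsNeighbor {V A : Type*} [LT V] (m : V → ℕ → A) (p : Pointers V)
    (s : Side) (ℓ : ℕ) (x y : V) : Prop :=
  (Connected p x y ∧ Agree m ℓ x y ∧ s.before x y) ∧
    ∀ w, Connected p x w → Agree m ℓ x w → s.before x w → w = y ∨ s.before y w

/-- The data structure is a (defectless) skip graph, or a disjoint union of skip graphs if it is
not connected: in every connected component, for every finite word `w`, the nodes whose membership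
vector starts with `w` form a sorted doubly-linked list at level `|w|`.  The null pointer occurs
precisely where there is no neighbour. -/
def IsSkipGraph {V A : Type*} [LT V] (m : V → ℕ → A) (p : Pointers V) : Prop :=
  ∀ s ℓ x y, p s ℓ x = some y ↔ IsNeighbor m p s ℓ x y

/-! ### Messages and message handlers -/

/-- The messages of the repair mechanism. A `side` names the pointer of the receiver that the
message is about, and also the direction in which the message is passed on. -/
inductive Msg (V : Type*)
  /-- backpointer repair: `new` asks to become the neighbour on side `side` -/
  | checkNeighbor (side : Side) (new : V) (ℓ : ℕ)
  /-- inter-level check: walks along level `ℓ` in direction `side`, on behalf of `x`, whose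
  neighbour on this side at level `ℓ + 1` was `z` -/
  | levelCheck (side : Side) (x z : V) (ℓ : ℕ)
  /-- looks at level `ℓ`, in direction `side`, for the last node before `t` -/
  | probe (side : Side) (t : V) (ℓ : ℕ)
  /-- `zipperOpF` for `side = R` and `zipperOpB` for `side = L` -/
  | zipper (side : Side) (t : V) (ℓ : ℕ)
  /-- `updateOp`; also used for `setLinkOp`, which has the same effect on its receiver -/
  | update (side : Side) (new : V) (ℓ : ℕ)
  /-- `buddyOp`: walks along level `ℓ` in direction `side`, to find the neighbour of `x` on this
  side at level `ℓ + 1` -/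
  | buddy (side : Side) (x : V) (ℓ : ℕ)
  /-- `getLinkOp`: `u` asks to become the neighbour on side `side` -/
  | getLink (side : Side) (u : V) (ℓ : ℕ)

/-- A message together with its receiver. -/
abbrev Packet (V : Type*) := V × Msg V

open scoped Classical in
/-- The neighbour of `v` on side `s` at level `ℓ` becomes `y`. -/
noncomputable def Pointers.set {V : Type*} (p : Pointers V) (s : Side) (ℓ : ℕ) (v y : V) :
    Pointers V :=
  fun s' ℓ' v' => if s' = s ∧ ℓ' = ℓ ∧ v' = v then some y else p s' ℓ' v'

section Handlers

variable {V A : Type*} [LinearOrder V]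

/-- Periodic check of a backpointer constraint: `v` sends `checkNeighborOp` to its neighbour on
side `s` at level `ℓ`. -/
def linkCheck (p : Pointers V) (v : V) (s : Side) (ℓ : ℕ) : List (Packet V) :=
  match p s ℓ v with
  | none => []
  | some w => [(w, .checkNeighbor s.opp v ℓ)]

/-- Periodic check of an inter-level constraint, between levels `ℓ` and `ℓ + 1`.
If `v` has a neighbour `z` on side `s` at level `ℓ + 1`, then it sends a message along level `ℓ`
to look for `z`; if `v` is itself the end of its list at level `ℓ`, then the message has already
reached the end of this list, and the two lists are to be merged.
If `v` is linked at level `ℓ` but not at level `ℓ + 1`, then it traverses level `ℓ`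
to find its neighbour at level `ℓ + 1`, as in an insert. -/
def interLevelCheck (p : Pointers V) (v : V) (s : Side) (ℓ : ℕ) : List (Packet V) :=
  match p s (ℓ + 1) v, p s ℓ v with
  | some z, some w => [(w, .levelCheck s v z ℓ)]
  | some z, none => [(z, .probe s.opp v ℓ)]
  | none, some w => [(w, .buddy s v ℓ)]
  | none, none => []

open scoped Classical in
/-- `checkNeighborOp(side, new, ℓ)` arrives at `v`. -/
noncomputable def onCheckNeighbor (p : Pointers V) (v : V) (s : Side) (new : V) (ℓ : ℕ) :
    Pointers V × List (Packet V) :=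
  match p s ℓ v with
  | none =>
      if s.before v new then (p.set s ℓ v new, [(new, .checkNeighbor s.opp v ℓ)]) else (p, [])
  | some w =>
      if w = new then (p, [])
      else if s.before w new then (p, [(w, .checkNeighbor s new ℓ)])
      else (p.set s ℓ v new,
        [(w, .checkNeighbor s.opp new ℓ), (new, .checkNeighbor s.opp v ℓ),
          (new, .checkNeighbor s w ℓ)])

open scoped Classical in
/-- The inter-level check of `x`, which looks for `z`, arrives at `a`. In order: `a` lies before
`z` and should be linked to `x` at level `ℓ + 1` (the level-`(ℓ + 1)` list of `a` is merged into the
link from `x` to `z`, both ways); `a` lies before `z` and is the end of the level-`ℓ` list (the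
level-`ℓ` list of `z` is merged with it); `a` lies before `z` (passed on); `a = z`
(nothing to repair); `a` lies beyond `z` (the level-`ℓ` list of `z` is merged into the link between
`a` and the predecessor of `a`, both ways). -/
noncomputable def onLevelCheck (m : V → ℕ → A) (p : Pointers V) (a : V) (s : Side) (x z : V)
    (ℓ : ℕ) : List (Packet V) :=
  if s.before a z then
    if Agree m (ℓ + 1) a x then [(a, .probe s z (ℓ + 1)), (a, .probe s.opp x (ℓ + 1))]
    else
      match p s ℓ a with
      | none => [(z, .probe s.opp a ℓ)]
      | some w => [(w, .levelCheck s x z ℓ)]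
  else if a = z then []
  else (z, .probe s a ℓ) ::
    match p s.opp ℓ a with
    | none => []
    | some b => if s.before b z then [(z, .probe s.opp b ℓ)] else []

open scoped Classical in
/-- A probe for `t` arrives at `y`: it is passed on as long as the next node still lies before `t`,
and otherwise the zipper is started at `y`. -/
noncomputable def onProbe (p : Pointers V) (y : V) (s : Side) (t : V) (ℓ : ℕ) : List (Packet V) :=
  match p s ℓ y with
  | none => [(y, .zipper s t ℓ)]
  | some w => if s.before w t then [(w, .probe s t ℓ)] else [(y, .zipper s t ℓ)]

open scoped Classical in
/-- `zipperOp(t, ℓ)` arrives at `v`. Nothing remains to be merged if `t` is already the neighbour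
of `v`. -/
noncomputable def onZipper (p : Pointers V) (v : V) (s : Side) (t : V) (ℓ : ℕ) :
    Pointers V × List (Packet V) :=
  match p s ℓ v with
  | none => (p.set s ℓ v t, [(t, .update s.opp v ℓ)])
  | some w =>
      if w = t then (p, [])
      else if s.before w t then (p, [(w, .zipper s t ℓ)])
      else (p.set s ℓ v t, [(t, .update s.opp v ℓ), (t, .zipper s w ℓ)])

open scoped Classical in
/-- `change_neighbor(u, side, ℓ)` at `v`, which is also the reaction to `getLinkOp(u, side, ℓ)`. -/
noncomputable def changeNeighbor (p : Pointers V) (v : V) (s : Side) (u : V) (ℓ : ℕ) :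
    Pointers V × List (Packet V) :=
  match p s ℓ v with
  | none => (p.set s ℓ v u, [(u, .update s.opp v ℓ)])
  | some w =>
      if s.before w u then (p, [(w, .getLink s u ℓ)])
      else (p.set s ℓ v u, [(u, .update s.opp v ℓ)])

open scoped Classical in
/-- The `buddyOp` of `x` arrives at `v`, having walked along level `ℓ` in direction `s`. -/
noncomputable def onBuddy (m : V → ℕ → A) (p : Pointers V) (v : V) (s : Side) (x : V) (ℓ : ℕ) :
    Pointers V × List (Packet V) :=
  if m v ℓ = m x ℓ then changeNeighbor p v s.opp x (ℓ + 1)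
  else
    match p s ℓ v with
    | none => (p, [])
    | some w => (p, [(w, .buddy s x ℓ)])

/-- The reaction of node `v` to a message: the new neighbour tables (only entries of `v` change)
and the messages that `v` sends. -/
noncomputable def handle (m : V → ℕ → A) (p : Pointers V) (v : V) :
    Msg V → Pointers V × List (Packet V)
  | .checkNeighbor s new ℓ => onCheckNeighbor p v s new ℓ
  | .levelCheck s x z ℓ => (p, onLevelCheck m p v s x z ℓ)
  | .probe s t ℓ => (p, onProbe p v s t ℓ)
  | .zipper s t ℓ => onZipper p v s t ℓ
  | .update s new ℓ => (p.set s ℓ v new, [])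
  | .buddy s x ℓ => onBuddy m p v s x ℓ
  | .getLink s u ℓ => changeNeighbor p v s u ℓ

end Handlers

/-! ### Asynchronous executions of the repair mechanism -/

/-- A global state: the neighbour tables of the nodes and the messages in transit. -/
structure State (V : Type*) where
  /-- the neighbour tables -/
  ptr : Pointers V
  /-- the messages in transit -/
  net : Multiset (Packet V)

/-- The atomic events: a node checks one of its backpointer constraints, a node checks one of
its inter-level constraints, a message is received and processed, or nothing happens. -/
inductive Event (V : Type*)
  | linkCheck (v : V) (s : Side) (ℓ : ℕ)
  | interLevelCheck (v : V) (s : Side) (ℓ : ℕ)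
  | deliver (c : Packet V)
  | idle

/-- The event leads from the first state to the second. -/
def Step {V A : Type*} [LinearOrder V] (m : V → ℕ → A) (σ : State V) :
    Event V → State V → Prop
  | .linkCheck v s ℓ, σ' => σ' = ⟨σ.ptr, σ.net + ↑(linkCheck σ.ptr v s ℓ)⟩
  | .interLevelCheck v s ℓ, σ' => σ' = ⟨σ.ptr, σ.net + ↑(interLevelCheck σ.ptr v s ℓ)⟩
  | .deliver c, σ' => ∃ rest, σ.net = c ::ₘ rest ∧
      σ' = ⟨(handle m σ.ptr c.1 c.2).1, rest + ↑(handle m σ.ptr c.1 c.2).2⟩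
  | .idle, σ' => σ' = σ

/-- A fair asynchronous execution of the repair mechanism, without failures, inserts or deletes.
Messages may be delayed arbitrarily and may overtake each other, but each message in transit is
eventually received; each node performs each of its periodic checks again and again. -/
structure IsExecution {V A : Type*} [LinearOrder V] (m : V → ℕ → A)
    (σ : ℕ → State V) (e : ℕ → Event V) : Prop where
  step : ∀ t, Step m (σ t) (e t) (σ (t + 1))
  linkCheck : ∀ v s ℓ t, ∃ t' ≥ t, e t' = .linkCheck v s ℓ
  interLevelCheck : ∀ v s ℓ t, ∃ t' ≥ t, e t' = .interLevelCheck v s ℓ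
  deliver : ∀ t, ∀ c ∈ (σ t).net, ∃ t' ≥ t, e t' = .deliver c

/-! ### Defective skip graphs -/

/-- A message in transit to `v` is well-formed: it never proposes a link in the wrong direction,
or a link at a level at which the nodes do not belong to the same list. -/
def WellFormed {V A : Type*} [LT V] (m : V → ℕ → A) (v : V) : Msg V → Prop
  | .checkNeighbor s new ℓ => s.before v new ∧ Agree m ℓ v new
  | .levelCheck s x z ℓ =>
      s.before x z ∧ Agree m (ℓ + 1) x z ∧ s.before x v ∧ Agree m ℓ x v
  | .probe s t ℓ => s.before v t ∧ Agree m ℓ v t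
  | .zipper s t ℓ => s.before v t ∧ Agree m ℓ v t
  | .update s new ℓ => s.before v new ∧ Agree m ℓ v new
  | .buddy s x ℓ => s.before x v ∧ Agree m ℓ x v
  | .getLink s u ℓ => s.before v u ∧ Agree m ℓ v u

/-- The possibly defective skip graphs on which the repair mechanism operates. All pointers point
in the right direction (`x R_ℓ > x` and `x L_ℓ < x` unless null) and link members of one level-`ℓ`
list; pointers may otherwise be missing, one-sided, inconsistent between levels, or skip nodes.
Messages of the repair mechanism may be in transit. -/
structure IsDefectiveSkipGraph {V A : Type*} [LT V] (m : V → ℕ → A) (σ : State V) : Prop where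
  before : ∀ s ℓ x y, σ.ptr s ℓ x = some y → s.before x y
  agree : ∀ s ℓ x y, σ.ptr s ℓ x = some y → Agree m ℓ x y
  wellFormed : ∀ c ∈ σ.net, WellFormed m c.1 c.2

end SkipGraph

/-!
The proof has two halves: the pointers stop changing, and pointers that have stopped changing form
a skip graph.

*The pointers stop changing.* A reaction to a message other than an update changes a pointer only
to a closer one, or from null to non-null, but an update overwrites whatever it finds. This is
controlled by a potential in which a pointer that spans an interval of `d` nodes weighs `4 ^ d`, an
update that proposes such a pointer weighs `2 * 4 ^ d`, and a null pointer is heavier than any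
other. A pointer that improves becomes at least four times lighter, which more than pays for the
update that goes with it, and an update pays for the pointer that it creates. The one exception is a
link request that meets a link that exists already: it sends an update without improving a pointer,
so requests (and the buddy messages that turn into them) have to carry the weight of that update.
The periodic checks send them only on behalf of null pointers. Since no pointer ever becomes null
again, from some time on they are sent only on behalf of pointers that stay null forever; such
requests are never granted, because the resulting update would be received and fill the pointer,
and so they may weigh nothing. From that time on no event increases the potential, and every change
of a pointer decreases it (`Step.potential_le`, `IsExecution.ptr_eventually_const`).

*Pointers at rest form a skip graph.* By fairness, everything that is sent from then on is received
without effect (`Quiescent`). Each message can therefore be followed to the end of its walk, where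
the absence of an effect says something about the pointers: by the backpointer checks every link is
a link in both directions (`Quiescent.symm`); by the inter-level checks a link at level `ℓ + 1` is
bridged by a walk at level `ℓ` (`Quiescent.reach_of_succ`), so that level `0` already connects each
component. Then the levels are in order by induction: level `0` because it is a connected
doubly-linked list, and level `ℓ + 1` because a skipped node would be met by an inter-level check
(`Quiescent.eq_or_before_of_succ`) and a missing link would be found by a buddy message
(`Quiescent.ne_none_succ`).
-/

namespace SkipGraph

variable {V A : Type*}

/-! ### Sides and prefixes -/

@[simp] lemma Side.opp_opp (s : Side) : s.opp.opp = s := by cases s <;> rfl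

@[simp] lemma Side.before_opp [LT V] (s : Side) (a b : V) :
    s.opp.before a b ↔ s.before b a := by cases s <;> rfl

lemma Side.before_irrefl [Preorder V] (s : Side) (a : V) : ¬ s.before a a := by
  cases s <;> exact lt_irrefl a

lemma Side.before.ne [Preorder V] {s : Side} {a b : V} (h : s.before a b) : a ≠ b := by
  rintro rfl
  exact s.before_irrefl _ h

lemma Side.before.trans [Preorder V] {s : Side} {a b c : V}
    (h : s.before a b) (h' : s.before b c) : s.before a c := by
  cases s
  · exact lt_trans (show c < b from h') h
  · exact lt_trans (show a < b from h) h'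

lemma Side.before.asymm [Preorder V] {s : Side} {a b : V}
    (h : s.before a b) : ¬ s.before b a :=
  fun h' => s.before_irrefl _ (h.trans h')

lemma Side.before_of_not [LinearOrder V] {s : Side} {a b : V}
    (h : ¬ s.before a b) (hne : a ≠ b) : s.before b a := by
  cases s
  · exact lt_of_le_of_ne (not_lt.1 (show ¬ b < a from h)) hne
  · exact lt_of_le_of_ne (not_lt.1 (show ¬ a < b from h)) hne.symm

lemma Side.before_wf [LinearOrder V] [Finite V] (s : Side) : WellFounded (s.before (V := V)) := by
  cases s
  · exact (wellFounded_gt : WellFounded fun a b : V => a > b)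
  · exact (wellFounded_lt : WellFounded fun a b : V => a < b)

lemma Side.after_wf [LinearOrder V] [Finite V] (s : Side) :
    WellFounded fun a b : V => s.before b a := by
  cases s
  exacts [Side.R.before_wf, Side.L.before_wf]

instance : Fintype Side := ⟨⟨↑[Side.L, Side.R], by simp⟩, fun s => by cases s <;> simp⟩

lemma Agree.symm {m : V → ℕ → A} {ℓ : ℕ} {x y : V} (h : Agree m ℓ x y) : Agree m ℓ y x :=
  fun i hi => (h i hi).symm

lemma Agree.trans {m : V → ℕ → A} {ℓ : ℕ} {x y z : V} (h : Agree m ℓ x y)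
    (h' : Agree m ℓ y z) : Agree m ℓ x z :=
  fun i hi => (h i hi).trans (h' i hi)

lemma Agree.of_succ {m : V → ℕ → A} {ℓ : ℕ} {x y : V} (h : Agree m (ℓ + 1) x y) :
    Agree m ℓ x y :=
  fun i hi => h i (by omega)

lemma Agree.succ {m : V → ℕ → A} {ℓ : ℕ} {x y : V} (h : Agree m ℓ x y) (h' : m x ℓ = m y ℓ) :
    Agree m (ℓ + 1) x y := fun i hi => by
  rcases Nat.lt_succ_iff_lt_or_eq.1 hi with h1 | rfl
  exacts [h i h1, h']

/-- Above some level every list has a single member. -/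
lemma exists_level_bound [Finite V] {m : V → ℕ → A} (hm : Function.Injective m) :
    ∃ N, ∀ ℓ x y, N ≤ ℓ → Agree m ℓ x y → x = y := by
  have h : ∀ᶠ N in Filter.atTop, ∀ x y : V, x ≠ y → ∃ i < N, m x i ≠ m y i := by
    refine Filter.eventually_all.2 fun x => Filter.eventually_all.2 fun y => ?_
    by_cases hxy : x = y
    · exact .of_forall fun _ h => (h hxy).elim
    · obtain ⟨i, hi⟩ := Function.ne_iff.1 (hm.ne hxy)
      filter_upwards [Filter.eventually_gt_atTop i] with N hN _
      exact ⟨i, hN, hi⟩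
  obtain ⟨N, hN⟩ := h.exists
  refine ⟨N, fun ℓ x y hℓ hxy => ?_⟩
  by_contra hne
  obtain ⟨i, hi, h⟩ := hN x y hne
  exact h (hxy i (hi.trans_le hℓ))

/-! ### Well-formedness is preserved -/

/-- Every pointer on side `s` points in direction `s`, to a member of the same list. -/
def Directed [LT V] (m : V → ℕ → A) (p : Pointers V) : Prop :=
  ∀ s ℓ x y, p s ℓ x = some y → s.before x y ∧ Agree m ℓ x y

lemma Pointers.set_self (p : Pointers V) (s : Side) (ℓ : ℕ) (v y : V) :
    p.set s ℓ v y s ℓ v = some y := by simp [Pointers.set]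

lemma Pointers.set_of_ne (p : Pointers V) {s s' : Side} {ℓ ℓ' : ℕ} {v v' : V} (y : V)
    (h : ¬ (s' = s ∧ ℓ' = ℓ ∧ v' = v)) : p.set s ℓ v y s' ℓ' v' = p s' ℓ' v' := by
  simp [Pointers.set, h]

lemma Pointers.set_eq_self (p : Pointers V) {s : Side} {ℓ : ℕ} {v y : V}
    (h : p s ℓ v = some y) : p.set s ℓ v y = p := by
  funext s' ℓ' v'
  by_cases h' : s' = s ∧ ℓ' = ℓ ∧ v' = v
  · obtain ⟨rfl, rfl, rfl⟩ := h'
    rw [set_self, h]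
  · exact p.set_of_ne y h'

lemma Pointers.eq_of_set_eq {p : Pointers V} {s : Side} {ℓ : ℕ} {v y : V}
    (h : p.set s ℓ v y = p) : p s ℓ v = some y := by
  rw [← h, set_self]

lemma Pointers.set_ne_none (p : Pointers V) {s s' : Side} {ℓ ℓ' : ℕ} {v v' : V} (y : V)
    (h : p s' ℓ' v' ≠ none) : p.set s ℓ v y s' ℓ' v' ≠ none := by
  unfold Pointers.set
  split <;> simp [h]

section
variable [LinearOrder V] {m : V → ℕ → A} {p : Pointers V}

lemma Directed.set (hp : Directed m p) {s : Side} {ℓ : ℕ} {v y : V}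
    (h : s.before v y) (h' : Agree m ℓ v y) : Directed m (p.set s ℓ v y) := by
  intro s' ℓ' x z hz
  by_cases hx : s' = s ∧ ℓ' = ℓ ∧ x = v
  · obtain ⟨rfl, rfl, rfl⟩ := hx
    rw [Pointers.set_self, Option.some_inj] at hz
    exact hz ▸ ⟨h, h'⟩
  · rw [p.set_of_ne y hx] at hz
    exact hp _ _ _ _ hz

/-- A reaction leaves directed pointers and sends only well-formed messages. -/
def GoodReaction (m : V → ℕ → A) (r : Pointers V × List (Packet V)) : Prop :=
  Directed m r.1 ∧ ∀ c ∈ r.2, WellFormed m c.1 c.2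

lemma goodReaction_changeNeighbor (hp : Directed m p) {v u : V} {s : Side} {ℓ : ℕ}
    (hb : s.before v u) (ha : Agree m ℓ v u) : GoodReaction m (changeNeighbor p v s u ℓ) := by
  unfold changeNeighbor
  split
  · exact ⟨hp.set hb ha, by simp [WellFormed, hb, ha.symm]⟩
  · rename_i w hw
    split_ifs with h
    · exact ⟨hp, by simpa [WellFormed, h] using (hp _ _ _ _ hw).2.symm.trans ha⟩
    · exact ⟨hp.set hb ha, by simp [WellFormed, hb, ha.symm]⟩

lemma goodReaction_onCheckNeighbor (hp : Directed m p) {v n : V} {s : Side} {ℓ : ℕ}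
    (hb : s.before v n) (ha : Agree m ℓ v n) : GoodReaction m (onCheckNeighbor p v s n ℓ) := by
  unfold onCheckNeighbor
  split
  · rw [if_pos hb]
    exact ⟨hp.set hb ha, by simp [WellFormed, hb, ha.symm]⟩
  · rename_i w hw
    have hwa := (hp _ _ _ _ hw).2.symm.trans ha
    split_ifs with h h'
    · exact ⟨hp, by simp⟩
    · exact ⟨hp, by simpa [WellFormed, h'] using hwa⟩
    · exact ⟨hp.set hb ha, by
        simp [WellFormed, hb, ha.symm, Side.before_of_not h' h, hwa, hwa.symm]⟩

lemma goodReaction_onZipper (hp : Directed m p) {v n : V} {s : Side} {ℓ : ℕ}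
    (hb : s.before v n) (ha : Agree m ℓ v n) : GoodReaction m (onZipper p v s n ℓ) := by
  unfold onZipper
  split
  · exact ⟨hp.set hb ha, by simp [WellFormed, hb, ha.symm]⟩
  · rename_i w hw
    have hwa := (hp _ _ _ _ hw).2.symm.trans ha
    split_ifs with h h'
    · exact ⟨hp, by simp⟩
    · exact ⟨hp, by simpa [WellFormed, h'] using hwa⟩
    · exact ⟨hp.set hb ha, by
        simp [WellFormed, hb, ha.symm, Side.before_of_not h' h, hwa.symm]⟩

lemma wellFormed_onProbe (hp : Directed m p) {v t : V} {s : Side} {ℓ : ℕ}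
    (hb : s.before v t) (ha : Agree m ℓ v t) :
    ∀ c ∈ onProbe p v s t ℓ, WellFormed m c.1 c.2 := by
  unfold onProbe
  split
  · simp [WellFormed, hb, ha]
  · rename_i w hw
    split_ifs with h
    · simpa [WellFormed, h] using (hp _ _ _ _ hw).2.symm.trans ha
    · simp [WellFormed, hb, ha]

lemma wellFormed_onLevelCheck (hp : Directed m p) {v x z : V} {s : Side} {ℓ : ℕ}
    (hxz : s.before x z) (hxz' : Agree m (ℓ + 1) x z) (hxv : s.before x v)
    (hxv' : Agree m ℓ x v) :
    ∀ c ∈ onLevelCheck m p v s x z ℓ, WellFormed m c.1 c.2 := by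
  have hvz : Agree m ℓ v z := hxv'.symm.trans hxz'.of_succ
  unfold onLevelCheck
  split_ifs with h h' h'
  · simp [WellFormed, h, h', hxv, h'.trans hxz']
  · split
    · simp [WellFormed, h, hvz.symm]
    · rename_i w hw
      have := hp _ _ _ _ hw
      simp [WellFormed, hxz, hxz', hxv.trans this.1, hxv'.trans this.2]
  · simp
  · have hzv := Side.before_of_not h h'
    split
    · simp [WellFormed, hzv, hvz.symm]
    · rename_i b hb
      have := (hp _ _ _ _ hb).2
      split_ifs with hbz <;> simp [WellFormed, hzv, hvz.symm, hbz, hvz.symm.trans this]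

lemma goodReaction_handle (hp : Directed m p) {c : Packet V} (hc : WellFormed m c.1 c.2) :
    GoodReaction m (handle m p c.1 c.2) := by
  obtain ⟨v, _ | _ | _ | _ | _ | _ | _⟩ := c
  · exact goodReaction_onCheckNeighbor hp hc.1 hc.2
  · exact ⟨hp, wellFormed_onLevelCheck hp hc.1 hc.2.1 hc.2.2.1 hc.2.2.2⟩
  · exact ⟨hp, wellFormed_onProbe hp hc.1 hc.2⟩
  · exact goodReaction_onZipper hp hc.1 hc.2
  · exact ⟨hp.set hc.1 hc.2, by simp [handle]⟩
  · rename_i s x ℓ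
    dsimp only [handle]
    unfold onBuddy
    split_ifs with h
    · exact goodReaction_changeNeighbor hp (by simpa using hc.1) (hc.2.symm.succ h)
    · split
      · exact ⟨hp, by simp⟩
      · rename_i w hw
        have := hp _ _ _ _ hw
        exact ⟨hp, by simp [WellFormed, hc.1.trans this.1, hc.2.trans this.2]⟩
  · exact goodReaction_changeNeighbor hp hc.1 hc.2

lemma wellFormed_linkCheck (hp : Directed m p) (v : V) (s : Side) (ℓ : ℕ) :
    ∀ c ∈ linkCheck p v s ℓ, WellFormed m c.1 c.2 := by
  unfold linkCheck
  split
  · simp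
  · rename_i w hw
    have := hp _ _ _ _ hw
    simp [WellFormed, this.1, this.2.symm]

lemma wellFormed_interLevelCheck (hp : Directed m p) (v : V) (s : Side) (ℓ : ℕ) :
    ∀ c ∈ interLevelCheck p v s ℓ, WellFormed m c.1 c.2 := by
  unfold interLevelCheck
  split
  · rename_i z w hz hw
    simp [WellFormed, hp _ _ _ _ hz, hp _ _ _ _ hw]
  · rename_i z hz _
    have := hp _ _ _ _ hz
    simp [WellFormed, this.1, this.2.of_succ.symm]
  · rename_i w _ hw
    simp [WellFormed, hp _ _ _ _ hw]
  · simp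

lemma Step.wellFormed {σ σ' : State V} {e : Event V} (h : Step m σ e σ')
    (hp : Directed m σ.ptr) (hn : ∀ c ∈ σ.net, WellFormed m c.1 c.2) :
    Directed m σ'.ptr ∧ ∀ c ∈ σ'.net, WellFormed m c.1 c.2 := by
  cases e with
  | linkCheck v s ℓ =>
    obtain rfl : σ' = _ := h
    refine ⟨hp, fun c hc => (Multiset.mem_add.1 hc).elim (hn c) fun hc => ?_⟩
    exact wellFormed_linkCheck hp v s ℓ c (by simpa using hc)
  | interLevelCheck v s ℓ =>
    obtain rfl : σ' = _ := h
    refine ⟨hp, fun c hc => (Multiset.mem_add.1 hc).elim (hn c) fun hc => ?_⟩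
    exact wellFormed_interLevelCheck hp v s ℓ c (by simpa using hc)
  | deliver c =>
    obtain ⟨rest, hr, rfl⟩ := h
    have := goodReaction_handle hp (hn c (by simp [hr]))
    refine ⟨this.1, fun c' hc' => (Multiset.mem_add.1 hc').elim
      (fun h => hn c' (by simp [hr, h])) fun h => this.2 c' (by simpa using h)⟩
  | idle =>
    obtain rfl : σ' = σ := h
    exact ⟨hp, hn⟩

/-- No reaction makes a pointer null. -/
lemma Step.ne_none {σ σ' : State V} {e : Event V} (h : Step m σ e σ') {s : Side} {ℓ : ℕ} {v : V}
    (hv : σ.ptr s ℓ v ≠ none) : σ'.ptr s ℓ v ≠ none := by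
  have hchange : ∀ (w : V) (s' : Side) (u : V) (k : ℕ),
      (changeNeighbor σ.ptr w s' u k).1 s ℓ v ≠ none := by
    intro w s' u k
    unfold changeNeighbor
    split
    · exact Pointers.set_ne_none _ _ hv
    · split_ifs
      exacts [hv, Pointers.set_ne_none _ _ hv]
  cases e with
  | linkCheck | interLevelCheck | idle =>
    obtain rfl : σ' = _ := h
    exact hv
  | deliver c =>
    obtain ⟨rest, hr, rfl⟩ := h
    obtain ⟨w, _ | _ | _ | _ | _ | _ | _⟩ := c <;> dsimp only [handle]
    · unfold onCheckNeighbor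
      split <;> split_ifs <;> first | exact hv | exact Pointers.set_ne_none _ _ hv
    · exact hv
    · exact hv
    · unfold onZipper
      split <;> try split_ifs
      all_goals first | exact hv | exact Pointers.set_ne_none _ _ hv
    · exact Pointers.set_ne_none _ _ hv
    · unfold onBuddy
      split_ifs
      · exact hchange _ _ _ _
      · split <;> exact hv
    · exact hchange _ _ _ _

end

/-! ### Quiescent pointer tables are skip graphs -/

/-- The pointers `p` are at rest: `I` is a set of packets that contains what the periodic checks
send and is closed under the reactions, and none of its packets makes a node change a pointer. -/
structure Quiescent {V A : Type*} [LinearOrder V] (m : V → ℕ → A) (p : Pointers V)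
    (I : Set (Packet V)) : Prop where
  directed : Directed m p
  wellFormed : ∀ c ∈ I, WellFormed m c.1 c.2
  fixed : ∀ c ∈ I, (handle m p c.1 c.2).1 = p
  closed : ∀ c ∈ I, ∀ c' ∈ (handle m p c.1 c.2).2, c' ∈ I
  linkCheck : ∀ v s ℓ, ∀ c ∈ linkCheck p v s ℓ, c ∈ I
  interLevelCheck : ∀ v s ℓ, ∀ c ∈ interLevelCheck p v s ℓ, c ∈ I

/-- `y` is reached from `x` by following level-`ℓ` pointers on side `s`. -/
def Reach {V : Type*} (p : Pointers V) (s : Side) (ℓ : ℕ) : V → V → Prop :=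
  Relation.ReflTransGen fun a b => p s ℓ a = some b

/-- Walks from the same node in the same direction extend each other. -/
lemma Reach.total {V : Type*} {p : Pointers V} {s : Side} {ℓ : ℕ} {x y z : V}
    (hxy : Reach p s ℓ x y) (hxz : Reach p s ℓ x z) : Reach p s ℓ y z ∨ Reach p s ℓ z y :=
  Relation.ReflTransGen.total_of_right_unique
    (fun _ _ _ h₁ h₂ => Option.some_inj.1 (h₁.symm.trans h₂)) hxy hxz

lemma Connected.of_ptr {V : Type*} {p : Pointers V} {x y z : V} {s : Side} {ℓ : ℕ}
    (hxy : p s ℓ x = some y) (hxz : Connected p x z) : Connected p y z :=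
  .trans _ _ _ (.symm _ _ (.rel _ _ ⟨s, ℓ, hxy⟩)) hxz

section

variable {V A : Type*} [LinearOrder V] {m : V → ℕ → A} {p : Pointers V}

lemma IsNeighbor.unique {s : Side} {ℓ : ℕ} {x y z : V}
    (hy : IsNeighbor m p s ℓ x y) (hz : IsNeighbor m p s ℓ x z) : y = z := by
  obtain h₁ | h₁ := hy.2 z hz.1.1 hz.1.2.1 hz.1.2.2
  · exact h₁.symm
  obtain h₂ | h₂ := hz.2 y hy.1.1 hy.1.2.1 hy.1.2.2
  · exact h₂
  · exact (h₁.asymm h₂).elim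

variable [Finite V]

lemma exists_isNeighbor {s : Side} {ℓ : ℕ} {x w : V} (hc : Connected p x w)
    (ha : Agree m ℓ x w) (hb : s.before x w) : ∃ y, IsNeighbor m p s ℓ x y := by
  obtain ⟨y, hy, hmin⟩ := s.before_wf.has_min
    {y | Connected p x y ∧ Agree m ℓ x y ∧ s.before x y} ⟨w, hc, ha, hb⟩
  refine ⟨y, hy, fun z h₁ h₂ h₃ => ?_⟩
  by_cases hzy : z = y
  · exact .inl hzy
  · exact .inr (Side.before_of_not (hmin z ⟨h₁, h₂, h₃⟩) hzy)

/-- If level `ℓ` is in order, then a walk along level `ℓ` towards another member `w` of the list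
continues, and does not jump over `w`. -/
lemma exists_next {s : Side} {ℓ : ℕ}
    (hℓ : ∀ x y, p s ℓ x = some y ↔ IsNeighbor m p s ℓ x y) {v w : V} (hc : Connected p v w)
    (ha : Agree m ℓ v w) (hb : s.before v w) :
    ∃ y, p s ℓ v = some y ∧ s.before v y ∧ Connected p y w ∧ Agree m ℓ y w ∧
      (w = y ∨ s.before y w) := by
  obtain ⟨y, hy⟩ := exists_isNeighbor hc ha hb
  exact ⟨y, (hℓ v y).2 hy, hy.1.2.2, hc.of_ptr ((hℓ v y).2 hy), hy.1.2.1.symm.trans ha,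
    hy.2 w hc ha hb⟩

end

namespace Quiescent

variable {V A : Type*} [LinearOrder V] {m : V → ℕ → A} {p : Pointers V} {I : Set (Packet V)}

lemma checkNeighbor_cases (h : Quiescent m p I) {v n : V} {s : Side} {ℓ : ℕ}
    (hc : (v, .checkNeighbor s n ℓ) ∈ I) :
    p s ℓ v = some n ∨
      ∃ w, p s ℓ v = some w ∧ s.before w n ∧ (w, .checkNeighbor s n ℓ) ∈ I := by
  have hf := h.fixed _ hc
  have hcl := h.closed _ hc
  have hb : s.before v n := (h.wellFormed _ hc).1
  simp only [handle] at hf hcl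
  unfold onCheckNeighbor at hf hcl
  split at hf
  · rw [if_pos hb] at hf
    exact .inl (Pointers.eq_of_set_eq hf)
  · rename_i w hw
    simp only [hw] at hcl
    split_ifs at hf hcl with h1 h2
    · exact .inl (h1 ▸ hw)
    · exact .inr ⟨w, hw, h2, hcl _ (by simp)⟩
    · exact .inl (hw ▸ Pointers.eq_of_set_eq hf)

lemma zipper_eq (h : Quiescent m p I) {v t : V} {s : Side} {ℓ : ℕ}
    (hc : (v, .zipper s t ℓ) ∈ I) (hv : ∀ w, p s ℓ v = some w → ¬ s.before w t) :
    p s ℓ v = some t := by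
  have hf := h.fixed _ hc
  simp only [handle] at hf
  unfold onZipper at hf
  split at hf
  · exact Pointers.eq_of_set_eq hf
  · rename_i w hw
    rw [if_neg (hv w hw)] at hf
    split_ifs at hf with h1
    · rw [hw, h1]
    · exact Pointers.eq_of_set_eq hf

lemma eq_or_before_of_reach (h : Quiescent m p I) {s : Side} {ℓ : ℕ} {x y : V}
    (hxy : Reach p s ℓ x y) : x = y ∨ s.before x y := by
  induction hxy with
  | refl => exact .inl rfl
  | tail _ hbc ih =>
    have := (h.directed _ _ _ _ hbc).1
    exact .inr (ih.elim (fun h => h ▸ this) fun h => h.trans this)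

variable [Finite V]

/-- The walk of a check ends at a node that points to the node that asked for the link. -/
lemma exists_of_checkNeighbor (h : Quiescent m p I) {n : V} {s : Side} {ℓ : ℕ} (v : V)
    (hc : (v, .checkNeighbor s n ℓ) ∈ I) :
    ∃ y, (y = v ∨ s.before v y) ∧ p s ℓ y = some n := by
  have hwf := s.after_wf (V := V)
  induction v using hwf.induction with | _ v ih => ?_
  obtain hv | ⟨w, hw, -, hwI⟩ := h.checkNeighbor_cases hc
  · exact ⟨v, .inl rfl, hv⟩
  · have hvw := (h.directed _ _ _ _ hw).1
    obtain ⟨y, hy, hyn⟩ := ih w hvw hwI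
    refine ⟨y, .inr ?_, hyn⟩
    obtain rfl | hy := hy
    exacts [hvw, hvw.trans hy]

/-- Every link at rest is a link in both directions. -/
lemma symm (h : Quiescent m p I) {v w : V} {s : Side} {ℓ : ℕ} (hv : p s ℓ v = some w) :
    p s.opp ℓ w = some v := by
  obtain ⟨y, rfl | hy, hyv⟩ := h.exists_of_checkNeighbor w
    (h.linkCheck v s ℓ (w, .checkNeighbor s.opp v ℓ) (by simp [SkipGraph.linkCheck, hv]))
  · exact hyv
  -- Otherwise the walk has met `y` strictly between `v` and `w`; the check that `y` sends to `v`
  -- would then replace the pointer to `w`.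
  · rw [Side.before_opp] at hy
    have hc := h.linkCheck y s.opp ℓ (v, .checkNeighbor s y ℓ)
      (by simp [SkipGraph.linkCheck, hyv])
    obtain hvy | ⟨w', hw', hb, -⟩ := h.checkNeighbor_cases hc
    · obtain rfl : w = y := by simpa [hv] using hvy
      exact (s.before_irrefl _ hy).elim
    · obtain rfl : w = w' := by simpa [hv] using hw'
      exact (hb.asymm hy).elim

lemma symm_iff (h : Quiescent m p I) {v w : V} {s : Side} {ℓ : ℕ} :
    p s ℓ v = some w ↔ p s.opp ℓ w = some v :=
  ⟨h.symm, fun hw => by simpa using h.symm hw⟩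

/-- A probe ends at a node that is already linked to the target. -/
lemma exists_of_probe (h : Quiescent m p I) {t : V} {s : Side} {ℓ : ℕ} (v : V)
    (hc : (v, .probe s t ℓ) ∈ I) :
    ∃ y, (y = v ∨ s.before v y) ∧ p s ℓ y = some t := by
  have hwf := s.after_wf (V := V)
  induction v using hwf.induction with | _ v ih => ?_
  have hcl := h.closed _ hc
  simp only [handle] at hcl
  unfold onProbe at hcl
  split at hcl
  · rename_i hv
    exact ⟨v, .inl rfl, h.zipper_eq (hcl _ (by simp)) (by simp [hv])⟩
  · rename_i w hw
    split_ifs at hcl with h1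
    · have hvw := (h.directed _ _ _ _ hw).1
      obtain ⟨y, hy, hyn⟩ := ih w hvw (hcl _ (by simp))
      refine ⟨y, .inr ?_, hyn⟩
      obtain rfl | hy := hy
      exacts [hvw, hvw.trans hy]
    · exact ⟨v, .inl rfl, h.zipper_eq (hcl _ (by simp)) (by simpa [hw] using h1)⟩

/-- A node that is probed for has a neighbour on the side from which the probe comes. -/
lemma ne_none_of_probe (h : Quiescent m p I) {v t : V} {s : Side} {ℓ : ℕ}
    (hc : (v, .probe s.opp t ℓ) ∈ I) : p s ℓ t ≠ none := by
  obtain ⟨y, -, hy⟩ := h.exists_of_probe v hc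
  simp [h.symm_iff.2 hy]

/-- A request for a link is granted in the end, since the requests are passed on towards the node
that made them. -/
lemma ne_none_of_changeNeighbor (h : Quiescent m p I) {u : V} {s : Side} {ℓ : ℕ} (v : V)
    (hf : (changeNeighbor p v s u ℓ).1 = p) (hc : ∀ c ∈ (changeNeighbor p v s u ℓ).2, c ∈ I) :
    p s.opp ℓ u ≠ none := by
  have hwf := s.after_wf (V := V)
  induction v using hwf.induction with | _ v ih => ?_
  unfold changeNeighbor at hf hc
  split at hf
  · rename_i hv
    simp [hv] at hf hc
    simp [h.symm (Pointers.eq_of_set_eq hf)]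
  · rename_i w hw
    simp only [hw] at hc
    split_ifs at hf hc with h1
    · have hwI := hc (w, .getLink s u ℓ) (by simp)
      exact ih w (h.directed _ _ _ _ hw).1 (h.fixed _ hwI) (h.closed _ hwI)
    · simp [h.symm (Pointers.eq_of_set_eq hf)]

lemma ne_none_of_buddy (h : Quiescent m p I) {v x : V} {s : Side} {ℓ : ℕ}
    (hc : (v, .buddy s x ℓ) ∈ I) (hvx : m v ℓ = m x ℓ) : p s (ℓ + 1) x ≠ none := by
  have hf := h.fixed _ hc
  have hcl := h.closed _ hc
  simp only [handle, onBuddy, if_pos hvx] at hf hcl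
  simpa using h.ne_none_of_changeNeighbor v hf hcl

/-- No inter-level check meets a member of the list of its sender before the node it looks for. -/
lemma not_agree_of_levelCheck (h : Quiescent m p I) {v x z : V} {s : Side} {ℓ : ℕ}
    (hxz : p s (ℓ + 1) x = some z) (hvz : s.before v z)
    (hc : (v, .levelCheck s x z ℓ) ∈ I) : ¬ Agree m (ℓ + 1) v x := by
  intro hvx
  have hcl := h.closed _ hc
  simp only [handle, onLevelCheck, if_pos hvz, if_pos hvx] at hcl
  obtain ⟨y, hy, hyz⟩ := h.exists_of_probe v (hcl (v, .probe s z (ℓ + 1)) (by simp))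
  have hyx : y = x := by simpa [h.symm hxz] using (h.symm hyz).symm
  have hxv : s.before x v := (h.wellFormed _ hc).2.2.1
  obtain rfl | hy := hy
  · exact hxv.ne hyx.symm
  · exact hxv.asymm (hyx ▸ hy)

lemma levelCheck_next (h : Quiescent m p I) {v x z : V} {s : Side} {ℓ : ℕ}
    (hxz : p s (ℓ + 1) x = some z) (hvz : s.before v z)
    (hc : (v, .levelCheck s x z ℓ) ∈ I) :
    ∃ w, p s ℓ v = some w ∧ (w, .levelCheck s x z ℓ) ∈ I := by
  have hcl := h.closed _ hc
  simp only [handle, onLevelCheck, if_pos hvz,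
    if_neg (h.not_agree_of_levelCheck hxz hvz hc)] at hcl
  split at hcl
  · rename_i hv
    exact (h.ne_none_of_probe (hcl _ (List.mem_singleton_self _)) hv).elim
  · rename_i w hw
    exact ⟨w, hw, hcl _ (by simp)⟩

lemma levelCheck_first (h : Quiescent m p I) {x z : V} {s : Side} {ℓ : ℕ}
    (hxz : p s (ℓ + 1) x = some z) :
    ∃ w, p s ℓ x = some w ∧ (w, .levelCheck s x z ℓ) ∈ I := by
  have hcl := h.interLevelCheck x s ℓ
  unfold SkipGraph.interLevelCheck at hcl
  cases hx : p s ℓ x with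
  | none =>
    exact (h.ne_none_of_probe (hcl (z, .probe s.opp x ℓ) (by simp [hxz, hx])) hx).elim
  | some w => exact ⟨w, rfl, hcl _ (by simp [hxz, hx])⟩

lemma reach_of_levelCheck (h : Quiescent m p I) {x z : V} {s : Side} {ℓ : ℕ}
    (hxz : p s (ℓ + 1) x = some z) (v : V) (hc : (v, .levelCheck s x z ℓ) ∈ I)
    {b : V} (hbv : p s ℓ b = some v) (hbz : s.before b z) : Reach p s ℓ v z := by
  have hwf := s.after_wf (V := V)
  induction v using hwf.induction generalizing b with | _ v ih => ?_
  by_cases hvz : s.before v z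
  · obtain ⟨w, hw, hwI⟩ := h.levelCheck_next hxz hvz hc
    exact (ih w (h.directed _ _ _ _ hw).1 hwI hw hvz).head hw
  by_cases hne : v = z
  · exact hne ▸ .refl
  -- The walk has jumped over `z`, from `b` to `v`; the probe that `z` receives would change this.
  have hcl := h.closed _ hc
  simp only [handle, onLevelCheck, if_neg hvz, if_neg hne] at hcl
  obtain ⟨y, hy, hyv⟩ := h.exists_of_probe z (hcl (z, .probe s v ℓ) (List.mem_cons_self ..))
  have hyb : y = b := by simpa [h.symm hbv] using (h.symm hyv).symm
  subst hyb
  obtain rfl | hy := hy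
  · exact (s.before_irrefl _ hbz).elim
  · exact (hbz.asymm hy).elim

/-- A link at level `ℓ + 1` is bridged by a walk at level `ℓ`. -/
lemma reach_of_succ (h : Quiescent m p I) {x z : V} {s : Side} {ℓ : ℕ}
    (hxz : p s (ℓ + 1) x = some z) : Reach p s ℓ x z := by
  obtain ⟨w, hw, hwI⟩ := h.levelCheck_first hxz
  exact (h.reach_of_levelCheck hxz w hwI hw (h.directed _ _ _ _ hxz).1).head hw

lemma reach_zero (h : Quiescent m p I) {s : Side} {ℓ : ℕ} {x y : V} (hxy : p s ℓ x = some y) :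
    Reach p s 0 x y := by
  induction ℓ generalizing x y with
  | zero => exact .single hxy
  | succ ℓ ih =>
    have hr := h.reach_of_succ hxy
    clear hxy
    induction hr with
    | refl => exact .refl
    | tail _ hbc ih' => exact ih'.trans (ih hbc)

lemma reach_opp (h : Quiescent m p I) {s : Side} {ℓ : ℕ} {x y : V} (hxy : Reach p s ℓ x y) :
    Reach p s.opp ℓ y x := by
  induction hxy with
  | refl => exact .refl
  | tail _ hbc ih => exact ih.head (h.symm hbc)

/-- At rest, two connected nodes are joined by a walk along level `0`. -/
lemma reach_of_connected (h : Quiescent m p I) (s : Side) {x y : V} (hxy : Connected p x y) :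
    Reach p s 0 x y ∨ Reach p s.opp 0 x y := by
  have hs : ∀ {a b}, Reach p s.opp 0 a b → Reach p s 0 b a := fun h' => by
    simpa using h.reach_opp h'
  induction hxy with
  | rel x y hl =>
    obtain ⟨s', ℓ, hp⟩ := hl
    have := h.reach_zero hp
    cases s <;> cases s' <;> simp [Side.opp, this]
  | refl => exact .inl .refl
  | symm x y _ ih => exact ih.symm.imp hs h.reach_opp
  | trans x y z _ _ ih₁ ih₂ =>
    obtain h₁ | h₁ := ih₁ <;> obtain h₂ | h₂ := ih₂
    · exact .inl (h₁.trans h₂)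
    · exact ((h.reach_opp h₁).total h₂).symm.imp_left hs
    · exact ((hs h₁).total h₂).imp_right h.reach_opp
    · exact .inr (h₁.trans h₂)

lemma isNeighbor_zero (h : Quiescent m p I) (s : Side) (x y : V) :
    p s 0 x = some y ↔ IsNeighbor m p s 0 x y := by
  have key : ∀ w, Connected p x w → s.before x w →
      ∃ y', p s 0 x = some y' ∧ (w = y' ∨ s.before y' w) := by
    intro w hw hxw
    obtain hr | hr := h.reach_of_connected s hw
    · obtain rfl | ⟨y', hy', hr'⟩ := hr.cases_head
      · exact (s.before_irrefl _ hxw).elim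
      · exact ⟨y', hy', (h.eq_or_before_of_reach hr').imp_left Eq.symm⟩
    · obtain rfl | hwx := h.eq_or_before_of_reach hr
      · exact (s.before_irrefl _ hxw).elim
      · exact (hxw.asymm ((s.before_opp _ _).1 hwx)).elim
  constructor
  · intro hxy
    have := h.directed _ _ _ _ hxy
    refine ⟨⟨.rel _ _ ⟨s, 0, hxy⟩, this.2, this.1⟩, fun w hw _ hxw => ?_⟩
    obtain ⟨y', hy', hw'⟩ := key w hw hxw
    obtain rfl : y = y' := by simpa [hxy] using hy'
    exact hw'
  · rintro ⟨⟨hc, -, hb⟩, hmin⟩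
    obtain ⟨y', hy', hyy'⟩ := key y hc hb
    have := h.directed _ _ _ _ hy'
    obtain rfl | hyy'' := hmin y' (.rel _ _ ⟨s, 0, hy'⟩) this.2 this.1
    · exact hy'
    · obtain rfl | hyy' := hyy'
      · exact hy'
      · exact (hyy'.asymm hyy'').elim

/-- A link at level `ℓ + 1` skips no node: the inter-level check would meet it. -/
lemma eq_or_before_of_succ (h : Quiescent m p I) {s : Side} {ℓ : ℕ}
    (hℓ : ∀ x y, p s ℓ x = some y ↔ IsNeighbor m p s ℓ x y) {x z w : V}
    (hxz : p s (ℓ + 1) x = some z) (hc : Connected p x w) (ha : Agree m (ℓ + 1) x w)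
    (hb : s.before x w) : w = z ∨ s.before z w := by
  by_contra hcon
  rw [not_or] at hcon
  have hwz : s.before w z := by
    by_contra h'
    exact hcon.2 (Side.before_of_not h' hcon.1)
  have key : ∀ v, (v, .levelCheck s x z ℓ) ∈ I → Connected p v w → Agree m ℓ v w →
      ¬ (w = v ∨ s.before v w) := by
    intro v
    have hwf := s.after_wf (V := V)
    induction v using hwf.induction with | _ v ih => ?_
    rintro hv hvc hva (rfl | hvw)
    · exact h.not_agree_of_levelCheck hxz hwz hv ha.symm
    · obtain ⟨y, hy, hvy, hyc, hya, hyw⟩ := exists_next hℓ hvc hva hvw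
      obtain ⟨y', hy', hyI⟩ := h.levelCheck_next hxz (hvw.trans hwz) hv
      obtain rfl : y = y' := by simpa [hy] using hy'
      exact ih y hvy hyI hyc hya hyw
  obtain ⟨y, hy, -, hyc, hya, hyw⟩ := exists_next hℓ hc ha.of_succ hb
  obtain ⟨y', hy', hyI⟩ := h.levelCheck_first hxz
  obtain rfl : y = y' := by simpa [hy] using hy'
  exact key y hyI hyc hya hyw

/-- No link at level `ℓ + 1` is missing: the search for a buddy would find it. -/
lemma ne_none_succ (h : Quiescent m p I) {s : Side} {ℓ : ℕ}
    (hℓ : ∀ x y, p s ℓ x = some y ↔ IsNeighbor m p s ℓ x y) {x w : V}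
    (hc : Connected p x w) (ha : Agree m (ℓ + 1) x w) (hb : s.before x w) :
    p s (ℓ + 1) x ≠ none := by
  intro hx
  have key : ∀ v, (v, .buddy s x ℓ) ∈ I → Connected p v w → Agree m ℓ v w →
      ¬ (w = v ∨ s.before v w) := by
    intro v
    have hwf := s.after_wf (V := V)
    induction v using hwf.induction with | _ v ih => ?_
    intro hv hvc hva hvw
    have hne : m v ℓ ≠ m x ℓ := fun h' => h.ne_none_of_buddy hv h' hx
    obtain rfl | hvw := hvw
    · exact hne (ha ℓ (Nat.lt_succ_self ℓ)).symm
    · obtain ⟨y, hy, hvy, hyc, hya, hyw⟩ := exists_next hℓ hvc hva hvw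
      have hcl := h.closed _ hv
      simp only [handle, onBuddy, if_neg hne, hy] at hcl
      exact ih y hvy (hcl _ (by simp)) hyc hya hyw
  obtain ⟨y, hy, -, hyc, hya, hyw⟩ := exists_next hℓ hc ha.of_succ hb
  exact key y (h.interLevelCheck x s ℓ _ (by simp [SkipGraph.interLevelCheck, hx, hy])) hyc hya hyw

theorem isSkipGraph (h : Quiescent m p I) : IsSkipGraph m p := by
  intro s ℓ
  induction ℓ with
  | zero => exact h.isNeighbor_zero s
  | succ ℓ hℓ =>
    have hnb : ∀ x y, p s (ℓ + 1) x = some y → IsNeighbor m p s (ℓ + 1) x y := by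
      intro x y hxy
      have := h.directed _ _ _ _ hxy
      exact ⟨⟨.rel _ _ ⟨s, ℓ + 1, hxy⟩, this.2, this.1⟩, fun w hc ha hb =>
        h.eq_or_before_of_succ hℓ hxy hc ha hb⟩
    refine fun x y => ⟨hnb x y, fun hxy => ?_⟩
    obtain ⟨z, hz⟩ := Option.ne_none_iff_exists'.1 (h.ne_none_succ hℓ hxy.1.1 hxy.1.2.1 hxy.1.2.2)
    rw [hz, (hnb x z hz).unique hxy]

end Quiescent

/-! ### The potential -/

section Potential

variable {V A : Type*} [LinearOrder V]

/-- The length of the interval spanned by two nodes. -/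
noncomputable def len (x y : V) : ℕ := (Set.uIcc x y).ncard

lemma len_comm (x y : V) : len x y = len y x := by rw [len, Set.uIcc_comm, len]

/-- The weight of a pointer of `v`: the closer the neighbour, the smaller the weight. A null
pointer is heavier than any other. -/
noncomputable def ptrWeight (v : V) : Option V → ℕ
  | none => 4 ^ (Nat.card V + 1)
  | some y => 4 ^ len v y

/-- The total weight of the pointers on levels below `N`. -/
noncomputable def tableWeight [Fintype V] (N : ℕ) (p : Pointers V) : ℕ :=
  ∑ i : Side × Fin N × V, ptrWeight i.2.2 (p i.1 i.2.1 i.2.2)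

open scoped Classical in
/-- The weight of a message. An update pays for the pointer that it may make worse. A buddy or
link request pays for the update that it may cause, except if the pointer that it is meant to
provide is one of the pointers `Z` that stay null forever, in which case it causes none. The other
messages only ever make pointers better, and are free. -/
noncomputable def msgWeight (Z : Side → ℕ → V → Prop) : Packet V → ℕ
  | (v, .update _ n _) => 2 * 4 ^ len v n
  | (_, .buddy s x ℓ) => if Z s (ℓ + 1) x then 0 else 2 * 4 ^ Nat.card V
  | (_, .getLink s u ℓ) => if Z s.opp ℓ u then 0 else 2 * 4 ^ Nat.card V
  | _ => 0

/-- The potential of a state. -/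
noncomputable def potential [Fintype V] (N : ℕ) (Z : Side → ℕ → V → Prop) (σ : State V) : ℕ :=
  tableWeight N σ.ptr + (σ.net.map (msgWeight Z)).sum

/-- The total weight of a list of messages. -/
noncomputable def listWeight (Z : Side → ℕ → V → Prop) (l : List (Packet V)) : ℕ :=
  (l.map (msgWeight Z)).sum

variable [Fintype V]

lemma len_le (x y : V) : len x y ≤ Nat.card V := by
  rw [len, ← Set.ncard_univ]
  exact Set.ncard_le_ncard (Set.subset_univ _)

lemma len_lt {s : Side} {x y z : V} (hxy : s.before x y) (hyz : s.before y z) :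
    len x y < len x z := by
  refine Set.ncard_lt_ncard (Set.ssubset_iff_of_subset ?_ |>.2 ⟨z, Set.right_mem_uIcc, ?_⟩)
  · refine Set.uIcc_subset_uIcc_left ?_
    cases s
    · exact Set.mem_uIcc.2 (.inr ⟨le_of_lt hyz, le_of_lt hxy⟩)
    · exact Set.mem_uIcc.2 (.inl ⟨le_of_lt hxy, le_of_lt hyz⟩)
  · rw [Set.mem_uIcc]
    cases s
    · have h₁ : y < x := hxy
      have h₂ : z < y := hyz
      rintro (h | h)
      exacts [(h.1.trans_lt h₂).asymm h₁, h.1.not_gt h₂]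
    · have h₁ : x < y := hxy
      have h₂ : y < z := hyz
      rintro (h | h)
      exacts [h.2.not_gt h₂, (h₁.trans_le (h₂.le.trans h.2)).false]

lemma ptrWeight_none_ge (v y : V) : 4 * 4 ^ len v y ≤ ptrWeight v none := by
  rw [ptrWeight, pow_succ']
  exact Nat.mul_le_mul_left 4 (Nat.pow_le_pow_right (by norm_num) (len_le v y))

lemma ptrWeight_some_ge {s : Side} {v y z : V} (hy : s.before v y) (hz : s.before y z) :
    4 * 4 ^ len v y ≤ ptrWeight v (some z) := by
  rw [ptrWeight, ← pow_succ']
  exact Nat.pow_le_pow_right (by norm_num) (len_lt hy hz)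

lemma tableWeight_set {N : ℕ} (p : Pointers V) {s : Side} {ℓ : ℕ} {v : V} (y : V) (hℓ : ℓ < N) :
    tableWeight N (p.set s ℓ v y) + ptrWeight v (p s ℓ v) = tableWeight N p + 4 ^ len v y := by
  classical
  unfold tableWeight
  have hi := Finset.mem_univ ((s, ⟨ℓ, hℓ⟩, v) : Side × Fin N × V)
  rw [← Finset.add_sum_erase _ _ hi, ← Finset.add_sum_erase _
    (fun i : Side × Fin N × V => ptrWeight i.2.2 (p i.1 i.2.1 i.2.2)) hi]
  have : ∀ i ∈ Finset.univ.erase ((s, ⟨ℓ, hℓ⟩, v) : Side × Fin N × V),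
      ptrWeight i.2.2 (p.set s ℓ v y i.1 i.2.1 i.2.2) = ptrWeight i.2.2 (p i.1 i.2.1 i.2.2) := by
    rintro ⟨s', ℓ', v'⟩ hi
    rw [p.set_of_ne]
    rintro ⟨rfl, h, rfl⟩
    exact (Finset.mem_erase.1 hi).1 (by simp [← h])
  rw [Finset.sum_congr rfl this]
  simp only [Pointers.set_self, ptrWeight]
  omega

/-- The reaction `r` to a message of weight `w` does not increase the potential, and decreases
it if it changes a pointer. -/
def Descends (N : ℕ) (Z : Side → ℕ → V → Prop) (p : Pointers V) (w : ℕ)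
    (r : Pointers V × List (Packet V)) : Prop :=
  r.1 = p ∧ listWeight Z r.2 ≤ w ∨
    tableWeight N r.1 + listWeight Z r.2 < tableWeight N p + w

variable {m : V → ℕ → A} {p : Pointers V} {N : ℕ} {Z : Side → ℕ → V → Prop}

/-- A pointer that becomes at least four times lighter can pay for one update. -/
lemma descends_set {s : Side} {ℓ : ℕ} {v y : V} {w : ℕ} {l : List (Packet V)} (hℓ : ℓ < N)
    (hw : 4 * 4 ^ len v y ≤ ptrWeight v (p s ℓ v)) (hl : listWeight Z l ≤ 2 * 4 ^ len v y) :
    Descends N Z p w (p.set s ℓ v y, l) := by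
  have := tableWeight_set p y hℓ (s := s) (v := v)
  have : 0 < 4 ^ len v y := by positivity
  exact .inr (by dsimp only; omega)

/-- The case of a request for a link that exists already is the one where the request itself has
to pay for the update. -/
lemma descends_changeNeighbor {s : Side} {ℓ : ℕ} {v u : V} (hℓ : ℓ < N) (hb : s.before v u)
    (hZ : ∀ x s' n k, (x, .update s' n k) ∈ (changeNeighbor p v s u ℓ).2 → ¬ Z s' k x) :
    Descends N Z p (msgWeight Z (v, .getLink s u ℓ)) (changeNeighbor p v s u ℓ) := by
  unfold changeNeighbor at hZ ⊢
  split
  · rename_i h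
    exact descends_set hℓ (h ▸ ptrWeight_none_ge v u)
      (by simp [listWeight, msgWeight, len_comm u v])
  · rename_i w hw
    simp only [hw] at hZ
    split_ifs at hZ ⊢ with h
    · exact .inl ⟨rfl, by simp [listWeight, msgWeight]⟩
    · have hZu : ¬ Z s.opp ℓ u := hZ u s.opp v ℓ (by simp)
      by_cases hwu : w = u
      · subst hwu
        refine .inl ⟨p.set_eq_self hw, ?_⟩
        simpa [listWeight, msgWeight, hZu, len_comm w v] using
          Nat.pow_le_pow_right (by norm_num) (len_le v w)
      · exact descends_set hℓ (hw ▸ ptrWeight_some_ge hb (Side.before_of_not h hwu))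
          (by simp [listWeight, msgWeight, len_comm u v])

lemma descends_handle (hN : ∀ ℓ x y, N ≤ ℓ → Agree m ℓ x y → x = y) {c : Packet V}
    (hc : WellFormed m c.1 c.2)
    (hZ : ∀ x s n k, (x, .update s n k) ∈ (handle m p c.1 c.2).2 → ¬ Z s k x) :
    Descends N Z p (msgWeight Z c) (handle m p c.1 c.2) := by
  have hlt : ∀ {s : Side} {ℓ x y}, s.before x y → Agree m ℓ x y → ℓ < N := by
    intro s ℓ x y hb ha
    by_contra h
    exact hb.ne (hN ℓ x y (not_lt.1 h) ha)
  obtain ⟨v, ⟨s, n, ℓ⟩ | ⟨s, x, z, ℓ⟩ | ⟨s, t, ℓ⟩ | ⟨s, t, ℓ⟩ | ⟨s, n, ℓ⟩ | ⟨s, x, ℓ⟩ |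
    ⟨s, u, ℓ⟩⟩ := c <;> dsimp only [handle] at hZ ⊢
  · have hℓ := hlt hc.1 hc.2
    unfold onCheckNeighbor
    split
    · rename_i h
      rw [if_pos hc.1]
      exact descends_set hℓ (h ▸ ptrWeight_none_ge v n) (by simp [listWeight, msgWeight])
    · rename_i w hw
      split_ifs with h h'
      · exact .inl ⟨rfl, by simp [listWeight]⟩
      · exact .inl ⟨rfl, by simp [listWeight, msgWeight]⟩
      · exact descends_set hℓ (hw ▸ ptrWeight_some_ge hc.1 (Side.before_of_not h' h))
          (by simp [listWeight, msgWeight])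
  · refine .inl ⟨rfl, ?_⟩
    unfold onLevelCheck
    split_ifs
    · simp [listWeight, msgWeight]
    · split <;> simp [listWeight, msgWeight]
    · simp [listWeight]
    · split
      · simp [listWeight, msgWeight]
      · split_ifs <;> simp [listWeight, msgWeight]
  · refine .inl ⟨rfl, ?_⟩
    unfold onProbe
    split
    · simp [listWeight, msgWeight]
    · split_ifs <;> simp [listWeight, msgWeight]
  · have hℓ := hlt hc.1 hc.2
    unfold onZipper
    split
    · rename_i h
      exact descends_set hℓ (h ▸ ptrWeight_none_ge v t)
        (by simp [listWeight, msgWeight, len_comm t v])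
    · rename_i w hw
      split_ifs with h h'
      · exact .inl ⟨rfl, by simp [listWeight]⟩
      · exact .inl ⟨rfl, by simp [listWeight, msgWeight]⟩
      · exact descends_set hℓ (hw ▸ ptrWeight_some_ge hc.1 (Side.before_of_not h' h))
          (by simp [listWeight, msgWeight, len_comm t v])
  · have := tableWeight_set p n (hlt hc.1 hc.2) (s := s) (v := v)
    have : 0 < 4 ^ len v n := by positivity
    exact .inr (by simp only [listWeight, msgWeight, List.map_nil, List.sum_nil]; omega)
  · unfold onBuddy at hZ ⊢
    split_ifs at hZ ⊢ with h
    · have hb : s.opp.before v x := (s.before_opp v x).2 hc.1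
      have hw : msgWeight Z (v, .buddy s x ℓ) = msgWeight Z (v, .getLink s.opp x (ℓ + 1)) := by
        cases s <;> rfl
      exact hw ▸ descends_changeNeighbor (hlt hb (hc.2.symm.succ h)) hb hZ
    · split
      · exact .inl ⟨rfl, by simp [listWeight]⟩
      · exact .inl ⟨rfl, by simp [listWeight, msgWeight]⟩
  · exact descends_changeNeighbor (hlt hc.1 hc.2) hc.1 hZ

lemma Step.potential_le (hN : ∀ ℓ x y, N ≤ ℓ → Agree m ℓ x y → x = y) {σ σ' : State V}
    {e : Event V} (h : Step m σ e σ') (hn : ∀ c ∈ σ.net, WellFormed m c.1 c.2)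
    (hnull : ∀ s ℓ v, σ.ptr s ℓ v = none → Z s ℓ v)
    (hZ : ∀ x s n k, (x, .update s n k) ∈ σ'.net → ¬ Z s k x) :
    potential N Z σ' ≤ potential N Z σ ∧
      (σ'.ptr ≠ σ.ptr → potential N Z σ' < potential N Z σ) := by
  cases e with
  | linkCheck v s ℓ =>
    obtain rfl : σ' = _ := h
    refine ⟨?_, fun h => (h rfl).elim⟩
    unfold linkCheck
    split <;> simp [potential, msgWeight]
  | interLevelCheck v s ℓ =>
    obtain rfl : σ' = _ := h
    refine ⟨?_, fun h => (h rfl).elim⟩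
    unfold interLevelCheck
    split
    · simp [potential, msgWeight]
    · simp [potential, msgWeight]
    · rename_i hv _
      simp [potential, msgWeight, hnull _ _ _ hv]
    · simp [potential]
  | deliver c =>
    obtain ⟨rest, hr, rfl⟩ := h
    have hd := descends_handle (p := σ.ptr) (Z := Z) hN (hn c (by simp [hr]))
      fun x s n k hx => hZ x s n k (by simp [hx])
    have h₀ : potential N Z σ =
        tableWeight N σ.ptr + (msgWeight Z c + (rest.map (msgWeight Z)).sum) := by
      rw [potential, hr, Multiset.map_cons, Multiset.sum_cons]
    have h₁ : ∀ (p : Pointers V) (l : List (Packet V)), potential N Z ⟨p, rest + ↑l⟩ =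
        tableWeight N p + ((rest.map (msgWeight Z)).sum + listWeight Z l) := fun p l => by
      rw [potential, Multiset.map_add, Multiset.sum_add, Multiset.map_coe, Multiset.sum_coe,
        listWeight]
    rw [h₀, h₁]
    rcases hd with ⟨h₂, h₃⟩ | h₂
    · refine ⟨?_, fun h => (h h₂).elim⟩
      rw [h₂]
      omega
    · exact ⟨by omega, fun _ => by omega⟩
  | idle =>
    obtain rfl : σ' = σ := h
    exact ⟨le_rfl, fun h => (h rfl).elim⟩

end Potential

/-! ### Executions come to rest -/

/-- A sequence of states whose potential is eventually nonincreasing, and decreases when the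
observed value changes, has an eventually constant observed value. -/
lemma exists_eventually_const {α : Type*} {f : ℕ → α} {Φ : ℕ → ℕ} {T₀ : ℕ}
    (hle : ∀ t ≥ T₀, Φ (t + 1) ≤ Φ t) (hlt : ∀ t ≥ T₀, f (t + 1) ≠ f t → Φ (t + 1) < Φ t) :
    ∃ T, ∀ t ≥ T, f t = f T := by
  obtain ⟨T, hT, hmin⟩ := WellFounded.has_min (measure Φ).wf {t | T₀ ≤ t} ⟨T₀, le_refl T₀⟩
  have hmin' : ∀ t ≥ T₀, Φ T ≤ Φ t := fun t ht => not_lt.1 (hmin t ht)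
  have hT : T₀ ≤ T := hT
  have key : ∀ t ≥ T, Φ t ≤ Φ T ∧ f t = f T := by
    intro t ht
    induction t, ht using Nat.le_induction with
    | base => exact ⟨le_rfl, rfl⟩
    | succ t ht ih =>
      have htT : T₀ ≤ t := hT.trans ht
      have h := hmin' (t + 1) (by omega)
      refine ⟨(hle t htT).trans ih.1, ?_⟩
      by_contra hne
      have := hlt t htT (fun h' => hne (h'.trans ih.2))
      omega
  exact ⟨T, fun t ht => (key t ht).2⟩

section Execution

variable {V A : Type*} [LinearOrder V] {m : V → ℕ → A} {σ : ℕ → State V}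
  {e : ℕ → Event V}

lemma IsExecution.wellFormed (he : IsExecution m σ e) (hσ : IsDefectiveSkipGraph m (σ 0)) (t : ℕ) :
    Directed m (σ t).ptr ∧ ∀ c ∈ (σ t).net, WellFormed m c.1 c.2 := by
  induction t with
  | zero =>
    exact ⟨fun s ℓ x y h => ⟨hσ.before s ℓ x y h, hσ.agree s ℓ x y h⟩, hσ.wellFormed⟩
  | succ t ih => exact (he.step t).wellFormed ih.1 ih.2

theorem IsExecution.ptr_eventually_const [Finite V] (hm : Function.Injective m)
    (he : IsExecution m σ e) (hσ : IsDefectiveSkipGraph m (σ 0)) :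
    ∃ T, ∀ t ≥ T, (σ t).ptr = (σ T).ptr := by
  cases nonempty_fintype V
  obtain ⟨N, hN⟩ := exists_level_bound hm
  have hwf := he.wellFormed hσ
  let Z : Side → ℕ → V → Prop := fun s ℓ v => ∀ t, (σ t).ptr s ℓ v = none
  -- There are finitely many pointers below level `N`, and none of them becomes null again.
  have hnull : ∀ᶠ t in Filter.atTop, ∀ s (ℓ : Fin N) v, (σ t).ptr s ℓ v = none → Z s ℓ v := by
    refine Filter.eventually_all.2 fun s => Filter.eventually_all.2 fun ℓ =>
      Filter.eventually_all.2 fun v => ?_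
    by_cases hz : Z s ℓ v
    · exact .of_forall fun _ _ => hz
    obtain ⟨t₀, ht₀⟩ := not_forall.1 hz
    filter_upwards [Filter.eventually_ge_atTop t₀] with t ht h
    refine (?_ : (σ t).ptr s ℓ v ≠ none) h |>.elim
    clear h
    induction t, ht using Nat.le_induction with
    | base => exact ht₀
    | succ t _ ih => exact (he.step t).ne_none ih
  obtain ⟨T₀, hT₀⟩ := Filter.eventually_atTop.1 hnull
  have hnull' : ∀ t ≥ T₀, ∀ s ℓ v, (σ t).ptr s ℓ v = none → Z s ℓ v := by
    intro t ht s ℓ v h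
    by_cases hℓ : ℓ < N
    · exact hT₀ t ht s ⟨ℓ, hℓ⟩ v h
    · intro t'
      by_contra h'
      obtain ⟨y, hy⟩ := Option.ne_none_iff_exists'.1 h'
      obtain ⟨h₁, h₂⟩ := (hwf t').1 _ _ _ _ hy
      exact h₁.ne (hN ℓ v y (not_lt.1 hℓ) h₂)
  -- Updates are received, so they are never sent to a pointer that stays null.
  have hZ : ∀ t, ∀ x s n k, (x, .update s n k) ∈ (σ t).net → ¬ Z s k x := by
    intro t x s n k hc hz
    obtain ⟨t', -, ht'⟩ := he.deliver t _ hc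
    have hs := he.step t'
    rw [ht'] at hs
    obtain ⟨rest, -, hs⟩ := hs
    have := hz (t' + 1)
    simp [hs, handle, Pointers.set_self] at this
  have key := fun t (ht : t ≥ T₀) =>
    (he.step t).potential_le hN (hwf t).2 (hnull' t ht) (hZ (t + 1))
  exact exists_eventually_const (Φ := fun t => potential N Z (σ t))
    (fun t ht => (key t ht).1) fun t ht => (key t ht).2

/-- Once the pointers have stopped changing, the packets in transit keep them at rest. -/
theorem IsExecution.quiescent (he : IsExecution m σ e) (hσ : IsDefectiveSkipGraph m (σ 0))
    {T : ℕ} {p : Pointers V} (hT : ∀ t ≥ T, (σ t).ptr = p) :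
    Quiescent m p {c | ∃ t ≥ T, c ∈ (σ t).net} := by
  have hdel : ∀ c, (∃ t ≥ T, c ∈ (σ t).net) → ∃ t ≥ T, (handle m p c.1 c.2).1 = p ∧
      ∀ c' ∈ (handle m p c.1 c.2).2, c' ∈ (σ t).net := by
    rintro c ⟨t, ht, hc⟩
    obtain ⟨t', ht', het⟩ := he.deliver t c hc
    have hs := he.step t'
    rw [het] at hs
    obtain ⟨rest, -, hs⟩ := hs
    have hp := hT (t' + 1) (by omega)
    rw [hT t' (by omega)] at hs
    rw [hs] at hp
    exact ⟨t' + 1, by omega, hp, fun c' hc' => by simp [hs, hc']⟩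
  refine ⟨hT T le_rfl ▸ (he.wellFormed hσ T).1, ?_, ?_, ?_, ?_, ?_⟩
  · rintro c ⟨t, -, hc⟩
    exact (he.wellFormed hσ t).2 c hc
  · intro c hc
    obtain ⟨t, -, h, -⟩ := hdel c hc
    exact h
  · intro c hc c' hc'
    obtain ⟨t, ht, -, h⟩ := hdel c hc
    exact ⟨t, ht, h c' hc'⟩
  · intro v s ℓ c hc
    obtain ⟨t, ht, het⟩ := he.linkCheck v s ℓ T
    have hs := he.step t
    rw [het] at hs
    obtain hs : σ (t + 1) = _ := hs
    exact ⟨t + 1, by omega, by simp [hs, hT t ht, hc]⟩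
  · intro v s ℓ c hc
    obtain ⟨t, ht, het⟩ := he.interLevelCheck v s ℓ T
    have hs := he.step t
    rw [het] at hs
    obtain hs : σ (t + 1) = _ := hs
    exact ⟨t + 1, by omega, by simp [hs, hT t ht, hc]⟩

end Execution

end SkipGraph

theorem mainTheorem6 {V A : Type*} [LinearOrder V] [Finite V]
    (m : V → ℕ → A) (hm : Function.Injective m)
    (σ : ℕ → SkipGraph.State V) (e : ℕ → SkipGraph.Event V)
    (hσ : SkipGraph.IsDefectiveSkipGraph m (σ 0))
    (he : SkipGraph.IsExecution m σ e) :
    ∃ T : ℕ, ∃ p : SkipGraph.Pointers V,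
      SkipGraph.IsSkipGraph m p ∧ ∀ t ≥ T, (σ t).ptr = p := by
  obtain ⟨T, hT⟩ := he.ptr_eventually_const hm hσ
  exact ⟨T, (σ T).ptr, (he.quiescent hσ hT).isSkipGraph, hT⟩
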